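/- Let $\Delta=\{z\in\mathbb C:|z|<1\}$ be the unit disc with the metric $g_\Delta=\frac{2|dz|^2}{(1-|z|^2)^2}$ of constant Gaussian curvature $-2$, and for $p\in\mathbb N$ let $g_{\Delta^p}$ be the product metric on the polydisc $\Delta^p$, each factor carrying $g_\Delta$. Let $\lambda>0$ be a real number and let $f\colon(\Delta,\lambda g_\Delta)\to(\Delta^p,g_{\Delta^p})$ be a $C^2$-smooth isometric embedding of Riemannian manifolds (a topological embedding with $f^*g_{\Delta^p}=\lambda g_\Delta$) which is totally geodesic, i.e. $D\,df=0$ for the connection $D$ induced by the Levi-Civita connections, and which extends to a $C^1$ map on the closed disc $\overline\Delta$. Then $\lambda$ is a positive integer, $\lambda\le p$, and there is a holomorphic automorphism $\Phi$ of $\Delta^p$ such that $$\Phi\circ f=(f_1,\dots,f_\lambda,0,\dots,0),$$ where each $f_j$ ($1\le j\le\lambda$) is either $\zeta\mapsto\zeta$ on all of $\Delta$ or $\zeta\mapsto\bar\zeta$ on all of $\Delta$. -/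

import Mathlib

open Complex ComplexConjugate Metric Set

noncomputable section

/-! ### Riemannian geometry on open subsets of real normed spaces -/

section Riemannian

variable {E F : Type*} [NormedAddCommGroup E] [NormedSpace ℝ E]
  [NormedAddCommGroup F] [NormedSpace ℝ F]

/-- `Γ` is the Levi-Civita connection of the metric `g` on the open set `U`: the covariant
derivative is `∇_X Y = DY(X) + Γ(X, Y)`, it has no torsion, and `g` is parallel. For a
(nondegenerate) metric there is at most one such `Γ` on `U`. -/
structure IsLeviCivita (U : Set E) (g : E → E →ₗ[ℝ] E →ₗ[ℝ] ℝ)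
    (Γ : E → E →ₗ[ℝ] E →ₗ[ℝ] E) : Prop where
  torsion_free : ∀ x ∈ U, ∀ u v, Γ x u v = Γ x v u
  metric_parallel : ∀ x ∈ U, ∀ u v w,
    fderiv ℝ (fun y => g y v w) x u = g x (Γ x u v) w + g x v (Γ x u w)

/-- The map `f : (U, g) → (V, h)` is totally geodesic: `D_X df = 0` for all `X`, where `D` is
induced by the Levi-Civita connections `Γ` of `g` and `Γ'` of `h`. In coordinates
`(D_u df)(v) = D²f(u, v) + Γ'_{f(x)}(df u, df v) - df(Γ_x(u, v))`. -/
def IsTotallyGeodesic (U : Set E) (g : E → E →ₗ[ℝ] E →ₗ[ℝ] ℝ)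
    (V : Set F) (h : F → F →ₗ[ℝ] F →ₗ[ℝ] ℝ) (f : E → F) : Prop :=
  ∃ Γ Γ', IsLeviCivita U g Γ ∧ IsLeviCivita V h Γ' ∧
    ∀ x ∈ U, ∀ u v,
      fderiv ℝ (fderiv ℝ f) x u v + Γ' (f x) (fderiv ℝ f x u) (fderiv ℝ f x v)
        - fderiv ℝ f x (Γ x u v) = 0

/-- `f : (U, g) → (V, h)` is an isometric embedding of Riemannian manifolds of class `C²`:
a topological embedding with `f^* h = g` (so in particular an immersion). -/
structure IsIsometricEmbedding (U : Set E) (g : E → E →ₗ[ℝ] E →ₗ[ℝ] ℝ)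
    (V : Set F) (h : F → F →ₗ[ℝ] F →ₗ[ℝ] ℝ) (f : E → F) : Prop where
  mapsTo : MapsTo f U V
  contDiffOn : ContDiffOn ℝ 2 f U
  isEmbedding : Topology.IsEmbedding (U.domRestrict f)
  pullback : ∀ x ∈ U, ∀ u v, h (f x) (fderiv ℝ f x u) (fderiv ℝ f x v) = g x u v

end Riemannian

/-! ### The disc, the polydisc, and their metrics -/

/-- The unit disc `Δ`. -/
def unitDisc : Set ℂ := ball 0 1

/-- The polydisc `Δ^p`. -/
def polydisc (p : ℕ) : Set (Fin p → ℂ) := {z | ∀ j, z j ∈ unitDisc}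

/-- The metric `g_Δ = 2 |dz|² / (1 - |z|²)²`, of constant Gaussian curvature `-2`. -/
def discMetric (z : ℂ) : ℂ →ₗ[ℝ] ℂ →ₗ[ℝ] ℝ :=
  (2 / (1 - ‖z‖ ^ 2) ^ 2) • innerₗ ℂ

/-- The metric `g_{Δ^p}`: the product of the metrics `g_Δ` of the factors. -/
def polydiscMetric (p : ℕ) (z : Fin p → ℂ) : (Fin p → ℂ) →ₗ[ℝ] (Fin p → ℂ) →ₗ[ℝ] ℝ :=
  ∑ j, (discMetric (z j)).compl₁₂ (LinearMap.proj j) (LinearMap.proj j)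

/-- `Φ` restricts to a holomorphic automorphism of the open set `U`, that is, to a holomorphic
bijection of `U` onto itself with holomorphic inverse. -/
def IsHolomorphicAut {E : Type*} [NormedAddCommGroup E] [NormedSpace ℂ E]
    (U : Set E) (Φ : E → E) : Prop :=
  ∃ Ψ : E → E, MapsTo Φ U U ∧ MapsTo Ψ U U ∧ InvOn Ψ Φ U U ∧
    DifferentiableOn ℂ Φ U ∧ DifferentiableOn ℂ Ψ U

end

/-! The Levi-Civita connection of a product acts factorwise, so every component `f_j : Δ → Δ` has
vanishing second fundamental form; it suffices to classify such maps.

For one of them the densities `|∂f|(1-|z|²)/(1-|f|²)` and `|∂̄f|(1-|z|²)/(1-|f|²)` are constants `a`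
and `b`, while the Hopf differential `H = ∂f · conj(∂̄f)/(1-|f|²)²` is holomorphic with
`|H|(1-|z|²)² = ab`. If `ab ≠ 0`, then `1/H` attains its maximum modulus at `0`, hence is constant,
which is absurd. So `f` or `conj f` is holomorphic (`dz_eq_zero_or_dzbar_eq_zero`) and scales the
Poincaré metric by a constant; the Schwarz lemma and the maximum principle make it constant or an
automorphism (`const_or_aut_of_homothety`).

In the pullback identity each nonconstant component contributes one copy of `g_Δ` and each constant
one nothing, so `λ` counts the nonconstant components. A permutation of the factors followed by
Möbius maps gives the normal form. -/

/-! ### Automorphisms of the disc -/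

/-- The Möbius transformation `w ↦ u (w - a) / (1 - ā w)`. -/
noncomputable def discMoebius (u a w : ℂ) : ℂ := u * ((w - a) / (1 - conj a * w))

theorem isOpen_unitDisc : IsOpen unitDisc := isOpen_ball

theorem isPreconnected_unitDisc : IsPreconnected unitDisc :=
  (convex_ball (0 : ℂ) 1).isPreconnected

theorem zero_mem_unitDisc : (0 : ℂ) ∈ unitDisc := mem_ball_self one_pos

theorem mem_unitDisc {z : ℂ} : z ∈ unitDisc ↔ ‖z‖ < 1 := mem_ball_zero_iff

theorem one_sub_sq_norm_pos {z : ℂ} (hz : z ∈ unitDisc) : 0 < 1 - ‖z‖ ^ 2 := by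
  have := mem_unitDisc.1 hz
  nlinarith [norm_nonneg z]

theorem conj_mem_unitDisc {z : ℂ} : conj z ∈ unitDisc ↔ z ∈ unitDisc := by
  simp [mem_unitDisc]

theorem one_sub_conj_mul_ne_zero {a w : ℂ} (ha : a ∈ unitDisc) (hw : w ∈ unitDisc) :
    1 - conj a * w ≠ 0 := by
  intro h
  have h1 : ‖conj a * w‖ = 1 := by rw [← sub_eq_zero.1 h, norm_one]
  rw [norm_mul, RCLike.norm_conj] at h1
  nlinarith [mem_unitDisc.1 ha, mem_unitDisc.1 hw, norm_nonneg a, norm_nonneg w]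

/-- Rests on `|1 - āw|² - |w - a|² = (1 - |a|²)(1 - |w|²)`. It shows that Möbius maps preserve the
disc and, together with the derivative formula, the metric. -/
theorem one_sub_sq_norm_discMoebius {u a w : ℂ} (hu : ‖u‖ = 1) (ha : a ∈ unitDisc)
    (hw : w ∈ unitDisc) :
    1 - ‖discMoebius u a w‖ ^ 2 =
      (1 - ‖a‖ ^ 2) * (1 - ‖w‖ ^ 2) / ‖1 - conj a * w‖ ^ 2 := by
  have hne := one_sub_conj_mul_ne_zero ha hw
  have hne' : ‖1 - conj a * w‖ ^ 2 ≠ 0 := by simpa using hne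
  rw [discMoebius, norm_mul, hu, one_mul, norm_div, div_pow, eq_div_iff hne', sub_mul,
    div_mul_cancel₀ _ hne']
  simp only [← Complex.normSq_eq_norm_sq, Complex.normSq_apply, sub_re, sub_im, mul_re, mul_im,
    conj_re, conj_im, one_re, one_im]
  ring

theorem discMoebius_mem_unitDisc {u a w : ℂ} (hu : ‖u‖ = 1) (ha : a ∈ unitDisc)
    (hw : w ∈ unitDisc) : discMoebius u a w ∈ unitDisc := by
  have h : 0 < 1 - ‖discMoebius u a w‖ ^ 2 := by
    rw [one_sub_sq_norm_discMoebius hu ha hw]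
    have := one_sub_sq_norm_pos ha
    have := one_sub_sq_norm_pos hw
    have := norm_pos_iff.2 (one_sub_conj_mul_ne_zero ha hw)
    positivity
  rw [mem_unitDisc]
  nlinarith [norm_nonneg (discMoebius u a w)]

theorem hasDerivAt_discMoebius {a w : ℂ} (u : ℂ) (ha : a ∈ unitDisc) (hw : w ∈ unitDisc) :
    HasDerivAt (discMoebius u a) (u * ((1 - (‖a‖ : ℂ) ^ 2) / (1 - conj a * w) ^ 2)) w := by
  have hne := one_sub_conj_mul_ne_zero ha hw
  have h1 : HasDerivAt (fun w : ℂ => w - a) 1 w := (hasDerivAt_id w).sub_const a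
  have h2 : HasDerivAt (fun w : ℂ => 1 - conj a * w) (-(conj a * 1)) w :=
    ((hasDerivAt_id w).const_mul (conj a)).const_sub 1
  refine ((h1.div h2 hne).const_mul u).congr_deriv ?_
  rw [← Complex.conj_mul']
  congr 2
  ring

theorem differentiableOn_discMoebius {a : ℂ} (u : ℂ) (ha : a ∈ unitDisc) :
    DifferentiableOn ℂ (discMoebius u a) unitDisc := fun _ hw =>
  (hasDerivAt_discMoebius u ha hw).differentiableAt.differentiableWithinAt

theorem discMoebius_inverse {u a w : ℂ} (hu : ‖u‖ = 1) (ha : a ∈ unitDisc)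
    (hw : w ∈ unitDisc) :
    discMoebius (conj u) (-(u * a)) (discMoebius u a w) = w := by
  have hne := one_sub_conj_mul_ne_zero ha hw
  have hna : (1 - conj a * a) ≠ 0 := one_sub_conj_mul_ne_zero ha ha
  have huu : conj u * u = 1 := by rw [Complex.conj_mul', hu]; norm_num
  have hnum : u * ((w - a) / (1 - conj a * w)) - -(u * a) =
      u * w * (1 - conj a * a) / (1 - conj a * w) := by
    rw [eq_div_iff hne, mul_div_assoc', sub_mul, div_mul_cancel₀ _ hne]; ring
  have hden : 1 - conj (-(u * a)) * (u * ((w - a) / (1 - conj a * w))) =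
      (1 - conj a * a) / (1 - conj a * w) := by
    rw [map_neg, map_mul, eq_div_iff hne]
    have : (1 - -(conj u * conj a) * (u * ((w - a) / (1 - conj a * w)))) * (1 - conj a * w) =
        (1 - conj a * w) + (conj u * u) * conj a * (w - a) := by
      rw [sub_mul, mul_assoc, mul_assoc u, div_mul_cancel₀ _ hne]; ring
    rw [this, huu]; ring
  rw [discMoebius, discMoebius, hnum, hden, div_div_div_cancel_right₀ hne,
    mul_div_cancel_right₀ _ hna, ← mul_assoc, huu, one_mul]

theorem discMoebius_inverse_right {u a w : ℂ} (hu : ‖u‖ = 1) (ha : a ∈ unitDisc)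
    (hw : w ∈ unitDisc) :
    discMoebius u a (discMoebius (conj u) (-(u * a)) w) = w := by
  have huu : conj u * u = 1 := by rw [Complex.conj_mul', hu]; norm_num
  have ha' : -(u * a) ∈ unitDisc := by
    rw [mem_unitDisc, norm_neg, norm_mul, hu, one_mul]; exact mem_unitDisc.1 ha
  have h := discMoebius_inverse (u := conj u) (by rw [RCLike.norm_conj, hu]) ha' hw
  rwa [Complex.conj_conj, mul_neg, neg_neg, ← mul_assoc, huu, one_mul] at h

theorem conj_discMoebius (u a w : ℂ) :
    conj (discMoebius u a w) = discMoebius (conj u) (conj a) (conj w) := by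
  simp [discMoebius]

/-! ### Holomorphic homotheties of the disc -/

/-- A holomorphic self-map of the disc fixing `0` and multiplying the Poincaré metric by a
nonzero constant is a rotation. -/
theorem eq_mul_of_homothety {k : ℂ → ℂ} {c : ℝ} (hc : c ≠ 0)
    (hk : DifferentiableOn ℂ k unitDisc) (hmaps : MapsTo k unitDisc unitDisc) (h0 : k 0 = 0)
    (hhom : ∀ z ∈ unitDisc, ‖deriv k z‖ * (1 - ‖z‖ ^ 2) = c * (1 - ‖k z‖ ^ 2)) :
    c = 1 ∧ ∃ u : ℂ, ‖u‖ = 1 ∧ ∀ z ∈ unitDisc, u * k z = z := by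
  have hc0 : ‖deriv k 0‖ = c := by simpa [h0] using hhom 0 zero_mem_unitDisc
  have hne : ∀ z ∈ unitDisc, deriv k z ≠ 0 := by
    intro z hz h
    have h1 := hhom z hz
    rw [h, norm_zero, zero_mul] at h1
    exact mul_ne_zero hc (one_sub_sq_norm_pos (hmaps hz)).ne' h1.symm
  have hcpos : 0 < c := hc0 ▸ norm_pos_iff.2 (hne 0 zero_mem_unitDisc)
  have hschwarz : ∀ z ∈ unitDisc, ‖k z‖ ≤ ‖z‖ := fun z hz =>
    Complex.norm_le_norm_of_mapsTo_ball hk (hmaps.mono_right ball_subset_closedBall) h0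
      (mem_unitDisc.1 hz)
  -- Schwarz gives `1 - |z|² ≤ 1 - |k z|²`, so `|k'| ≥ c = |k' 0|`: the maximum principle applies to
  -- `1/k'`.
  have hdk : DifferentiableOn ℂ (fun z => (deriv k z)⁻¹) unitDisc :=
    (hk.deriv isOpen_unitDisc).inv hne
  have hmax : IsMaxOn (norm ∘ fun z => (deriv k z)⁻¹) unitDisc 0 := by
    intro z hz
    simp only [mem_ofPred_eq, Function.comp_apply, norm_inv]
    refine inv_anti₀ (norm_pos_iff.2 (hne 0 zero_mem_unitDisc)) ?_
    rw [hc0]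
    have h1 := hhom z hz
    have h2 := hschwarz z hz
    have h3 : 1 - ‖z‖ ^ 2 ≤ 1 - ‖k z‖ ^ 2 := by
      have := norm_nonneg (k z)
      gcongr
    refine le_of_mul_le_mul_right ?_ (one_sub_sq_norm_pos hz)
    rw [h1]
    gcongr
  have hconst := Complex.eqOn_of_isPreconnected_of_isMaxOn_norm isPreconnected_unitDisc
    isOpen_unitDisc hdk zero_mem_unitDisc hmax
  have hderiv : ∀ z ∈ unitDisc, deriv k z = deriv k 0 := fun z hz => inv_injective (hconst hz)
  have heq : EqOn k (fun z => deriv k 0 * z) unitDisc := by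
    refine isOpen_unitDisc.eqOn_of_deriv_eq isPreconnected_unitDisc hk
      (by fun_prop) ?_ zero_mem_unitDisc (by simp [h0])
    intro z hz
    rw [hderiv z hz, ((hasDerivAt_id' z).const_mul (deriv k 0)).deriv, mul_one]
  -- With `k` linear, the homothety relation at any nonzero point forces `c² = 1`.
  have hhalf : (1 / 2 : ℂ) ∈ unitDisc := by rw [mem_unitDisc]; norm_num
  have hc1 : c = 1 := by
    have h1 := hhom _ hhalf
    rw [hderiv _ hhalf, hc0, heq hhalf] at h1
    have h2 := mul_left_cancel₀ hc h1
    rw [norm_mul, hc0] at h2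
    norm_num at h2
    nlinarith
  refine ⟨hc1, (deriv k 0)⁻¹, by rw [norm_inv, hc0, hc1, inv_one], fun z hz => ?_⟩
  rw [heq hz, inv_mul_cancel_left₀ (hne 0 zero_mem_unitDisc)]

/-- A holomorphic self-map of the disc multiplying the Poincaré metric by a constant is either
constant or an automorphism; in the second case the constant is `1`. -/
theorem const_or_aut_of_homothety {h : ℂ → ℂ} {c : ℝ}
    (hh : DifferentiableOn ℂ h unitDisc) (hmaps : MapsTo h unitDisc unitDisc)
    (hhom : ∀ z ∈ unitDisc, ‖deriv h z‖ * (1 - ‖z‖ ^ 2) = c * (1 - ‖h z‖ ^ 2)) :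
    (c = 0 ∧ ∀ z ∈ unitDisc, h z = h 0) ∨
      (c = 1 ∧ ∃ u : ℂ, ‖u‖ = 1 ∧ ∀ z ∈ unitDisc, discMoebius u (h 0) (h z) = z) := by
  by_cases hc : c = 0
  · refine Or.inl ⟨hc, fun z hz => ?_⟩
    refine isOpen_unitDisc.is_const_of_deriv_eq_zero isPreconnected_unitDisc hh ?_ hz
      zero_mem_unitDisc
    intro w hw
    have h1 := hhom w hw
    rw [hc, zero_mul, mul_eq_zero, norm_eq_zero] at h1
    exact h1.resolve_right (one_sub_sq_norm_pos hw).ne'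
  · right
    -- Composing with the Möbius isometry that sends `h 0` to `0` reduces to the normalised case.
    have ha := hmaps zero_mem_unitDisc
    have hderiv : ∀ z ∈ unitDisc, HasDerivAt (fun z => discMoebius 1 (h 0) (h z))
        (1 * ((1 - (‖h 0‖ : ℂ) ^ 2) / (1 - conj (h 0) * h z) ^ 2) * deriv h z) z := fun z hz =>
      (hasDerivAt_discMoebius 1 ha (hmaps hz)).comp z
        (hh.differentiableAt (isOpen_unitDisc.mem_nhds hz)).hasDerivAt
    have hk : ∀ z ∈ unitDisc, ‖deriv (fun z => discMoebius 1 (h 0) (h z)) z‖ * (1 - ‖z‖ ^ 2) =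
        c * (1 - ‖discMoebius 1 (h 0) (h z)‖ ^ 2) := by
      intro z hz
      have hpos := one_sub_sq_norm_pos ha
      have hn : ‖(1 - (‖h 0‖ : ℂ) ^ 2)‖ = 1 - ‖h 0‖ ^ 2 := by
        rw [show (1 - (‖h 0‖ : ℂ) ^ 2) = ((1 - ‖h 0‖ ^ 2 : ℝ) : ℂ) by push_cast; rfl,
          Complex.norm_real, Real.norm_of_nonneg hpos.le]
      rw [(hderiv z hz).deriv, one_sub_sq_norm_discMoebius norm_one ha (hmaps hz), one_mul,
        norm_mul, norm_div, norm_pow, hn, mul_assoc, hhom z hz]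
      ring
    obtain ⟨h1, u, hu, huk⟩ := eq_mul_of_homothety hc
      (fun z hz => (hderiv z hz).differentiableAt.differentiableWithinAt)
      (fun z hz => discMoebius_mem_unitDisc norm_one ha (hmaps hz)) (by simp [discMoebius]) hk
    refine ⟨h1, u, hu, fun z hz => ?_⟩
    exact (by simp [discMoebius] : discMoebius u (h 0) (h z) =
      u * discMoebius 1 (h 0) (h z)).trans (huk z hz)

/-! ### The Levi-Civita connections -/

/-- Koszul's formula determines the connection from the metric, so the existentially given `Γ`, `Γ'`
of `IsTotallyGeodesic` can be computed. -/
theorem IsLeviCivita.koszul {E : Type*} [NormedAddCommGroup E] [NormedSpace ℝ E] {U : Set E}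
    {g : E → E →ₗ[ℝ] E →ₗ[ℝ] ℝ} {Γ : E → E →ₗ[ℝ] E →ₗ[ℝ] E} (h : IsLeviCivita U g Γ)
    {x : E} (hx : x ∈ U) (hsymm : ∀ u v, g x u v = g x v u) (u v w : E) :
    2 * g x (Γ x u v) w = fderiv ℝ (fun y => g y v w) x u + fderiv ℝ (fun y => g y u w) x v
      - fderiv ℝ (fun y => g y u v) x w := by
  rw [h.metric_parallel x hx, h.metric_parallel x hx, h.metric_parallel x hx,
    h.torsion_free x hx v u, h.torsion_free x hx w u, h.torsion_free x hx w v,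
    hsymm u (Γ x v w), hsymm v (Γ x u w)]
  ring

theorem discMetric_apply (z u v : ℂ) :
    discMetric z u v = 2 / (1 - ‖z‖ ^ 2) ^ 2 * inner ℝ u v := rfl

theorem polydiscMetric_apply {p : ℕ} (z u v : Fin p → ℂ) :
    polydiscMetric p z u v = ∑ j, discMetric (z j) (u j) (v j) := by
  simp [polydiscMetric, LinearMap.sum_apply]

theorem hasFDerivAt_discMetric {z : ℂ} (hz : z ∈ unitDisc) (v w : ℂ) :
    HasFDerivAt (fun y => discMetric y v w)
      ((8 / (1 - ‖z‖ ^ 2) ^ 3 * inner ℝ v w) • innerSL ℝ z) z := by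
  have hne : 1 - ‖z‖ ^ 2 ≠ 0 := by
    have : ‖z‖ < 1 := mem_ball_zero_iff.1 hz
    nlinarith [norm_nonneg z]
  have h1 : HasFDerivAt (fun y : ℂ => ‖y‖ ^ 2) _ z := (hasFDerivAt_id (𝕜 := ℝ) z).norm_sq
  have h2 : HasDerivAt (fun s : ℝ => 2 / (1 - s) ^ 2 * inner ℝ v w)
      (4 / (1 - ‖z‖ ^ 2) ^ 3 * inner ℝ v w) (‖z‖ ^ 2) := by
    have h3 : HasDerivAt (fun s : ℝ => 1 - s) (-1) (‖z‖ ^ 2) :=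
      (hasDerivAt_id _).const_sub 1
    refine (((hasDerivAt_const _ (2 : ℝ)).div (h3.pow 2) (pow_ne_zero 2 hne)).mul_const
      (inner ℝ v w)).congr_deriv ?_
    congr 1
    field_simp
    norm_num
    ring
  refine (h2.comp_hasFDerivAt z h1).congr_fderiv ?_
  ext u
  simp
  ring

/-- Turns the Koszul expression of a conformal metric into a complex-bilinear Christoffel symbol. -/
theorem real_inner_christoffel (z u v w : ℂ) :
    inner ℝ z u * inner ℝ v w + inner ℝ z v * inner ℝ u w - inner ℝ z w * inner ℝ u v =
      inner ℝ (conj z * u * v) w := by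
  simp only [Complex.inner, mul_re, mul_im, map_mul, conj_re, conj_im]
  ring

theorem discMetric_symm (z u v : ℂ) : discMetric z u v = discMetric z v u := by
  rw [discMetric_apply, discMetric_apply, real_inner_comm]

/-- The Christoffel symbol of a multiple of the Poincaré metric. -/
theorem IsLeviCivita.eq_of_disc {c : ℝ} (hc : c ≠ 0) {Γ : ℂ → ℂ →ₗ[ℝ] ℂ →ₗ[ℝ] ℂ}
    (h : IsLeviCivita unitDisc (fun z => c • discMetric z) Γ) {z : ℂ} (hz : z ∈ unitDisc)
    (u v : ℂ) : Γ z u v = ((2 / (1 - ‖z‖ ^ 2) : ℝ) : ℂ) * (conj z * u * v) := by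
  have hne : 1 - ‖z‖ ^ 2 ≠ 0 := by
    have : ‖z‖ < 1 := mem_ball_zero_iff.1 hz
    nlinarith [norm_nonneg z]
  refine ext_inner_right ℝ fun w => ?_
  have hk := h.koszul hz (fun u v => by simp [discMetric_symm z u v]) u v w
  have hd : ∀ a b e : ℂ, fderiv ℝ (fun y => (c • discMetric y) a b) z e =
      c * (8 / (1 - ‖z‖ ^ 2) ^ 3 * inner ℝ a b * inner ℝ z e) := fun a b e => by
    have := ((hasFDerivAt_discMetric hz a b).const_mul c).fderiv
    simp only [LinearMap.smul_apply, smul_eq_mul]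
    rw [this]
    simp
  rw [hd, hd, hd, LinearMap.smul_apply, LinearMap.smul_apply, discMetric_apply, smul_eq_mul] at hk
  rw [← Complex.real_smul, real_inner_smul_left, ← real_inner_christoffel]
  field_simp at hk ⊢
  linarith

/-- The Christoffel symbol of the polydisc acts factorwise. -/
theorem IsLeviCivita.eq_of_polydisc {p : ℕ}
    {Γ : (Fin p → ℂ) → (Fin p → ℂ) →ₗ[ℝ] (Fin p → ℂ) →ₗ[ℝ] (Fin p → ℂ)}
    (h : IsLeviCivita (polydisc p) (polydiscMetric p) Γ) {z : Fin p → ℂ} (hz : z ∈ polydisc p)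
    (u v : Fin p → ℂ) (j : Fin p) :
    Γ z u v j = ((2 / (1 - ‖z j‖ ^ 2) : ℝ) : ℂ) * (conj (z j) * u j * v j) := by
  have hne : 1 - ‖z j‖ ^ 2 ≠ 0 := by
    have : ‖z j‖ < 1 := mem_ball_zero_iff.1 (hz j)
    nlinarith [norm_nonneg (z j)]
  refine ext_inner_right ℝ fun w => ?_
  have hk := h.koszul hz (fun u v => by
    simp_rw [polydiscMetric_apply]
    -- Testing against vectors supported in coordinate `j` isolates the `j`-th factor.
    exact Finset.sum_congr rfl fun i _ => discMetric_symm _ _ _) u v (Pi.single j w)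
  have hd : ∀ a b e : Fin p → ℂ, fderiv ℝ (fun y => polydiscMetric p y a b) z e =
      ∑ i, 8 / (1 - ‖z i‖ ^ 2) ^ 3 * inner ℝ (a i) (b i) * inner ℝ (z i) (e i) :=
    fun a b e => by
      simp_rw [polydiscMetric_apply]
      have := HasFDerivAt.fun_sum (u := Finset.univ) fun i (_ : i ∈ Finset.univ) =>
        (hasFDerivAt_discMetric (hz i) (a i) (b i)).comp z
          (ContinuousLinearMap.proj (R := ℝ) (φ := fun _ : Fin p => ℂ) i).hasFDerivAt
      simp only [Function.comp_def, ContinuousLinearMap.proj_apply] at this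
      rw [this.fderiv]
      simp
  have hs : ∀ (F : Fin p → ℂ → ℝ), (∀ i, F i 0 = 0) →
      ∑ i, F i ((Pi.single j w : Fin p → ℂ) i) = F j w := fun F hF => by
    rw [Finset.sum_eq_single j (fun i _ hi => by rw [Pi.single_eq_of_ne hi, hF])
      (by simp), Pi.single_eq_same]
  rw [hd, hd, hd, polydiscMetric_apply,
    hs (fun i w => discMetric (z i) (Γ z u v i) w) (by simp),
    hs (fun i w => 8 / (1 - ‖z i‖ ^ 2) ^ 3 * inner ℝ (v i) w * inner ℝ (z i) (u i)) (by simp),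
    hs (fun i w => 8 / (1 - ‖z i‖ ^ 2) ^ 3 * inner ℝ (u i) w * inner ℝ (z i) (v i)) (by simp),
    hs (fun i w => 8 / (1 - ‖z i‖ ^ 2) ^ 3 * inner ℝ (u i) (v i) * inner ℝ (z i) w) (by simp),
    discMetric_apply] at hk
  rw [← Complex.real_smul, real_inner_smul_left, ← real_inner_christoffel]
  field_simp at hk ⊢
  linarith

/-! ### Totally geodesic self-maps of the disc -/

section Wirtinger

/-- The Wirtinger derivative `∂f/∂z`. -/
noncomputable def dz (f : ℂ → ℂ) (z : ℂ) : ℂ := (fderiv ℝ f z 1 - I * fderiv ℝ f z I) / 2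

/-- The Wirtinger derivative `∂f/∂z̄`. -/
noncomputable def dzbar (f : ℂ → ℂ) (z : ℂ) : ℂ := (fderiv ℝ f z 1 + I * fderiv ℝ f z I) / 2

theorem fderiv_eq_dz_add_dzbar (f : ℂ → ℂ) (z u : ℂ) :
    fderiv ℝ f z u = dz f z * u + dzbar f z * conj u := by
  have hu : u = u.re • (1 : ℂ) + u.im • I := by simp
  have h1 : fderiv ℝ f z u = u.re * fderiv ℝ f z 1 + u.im * fderiv ℝ f z I := by
    conv_lhs => rw [hu, map_add, map_smul, map_smul]
    simp
  have h2 : conj u = u.re - u.im * I := by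
    apply Complex.ext <;> simp
  have h3 : u = u.re + u.im * I := (Complex.re_add_im u).symm
  rw [h1, h2, dz, dzbar]
  linear_combination (-(fderiv ℝ f z 1 - I * fderiv ℝ f z I) / 2) * h3 +
    (u.im * fderiv ℝ f z I) * I_sq

/-- `f : Δ → Δ` has vanishing second fundamental form for the Poincaré metrics. -/
def DiscAffine (f : ℂ → ℂ) : Prop :=
  ∀ z ∈ unitDisc, ∀ u v, fderiv ℝ (fderiv ℝ f) z u v =
    fderiv ℝ f z (((2 / (1 - ‖z‖ ^ 2) : ℝ) : ℂ) * (conj z * u * v)) -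
      ((2 / (1 - ‖f z‖ ^ 2) : ℝ) : ℂ) * (conj (f z) * fderiv ℝ f z u * fderiv ℝ f z v)

variable {f : ℂ → ℂ}

theorem hasFDerivAt_fderiv_apply (hf : ContDiffOn ℝ 2 f unitDisc) {z : ℂ} (hz : z ∈ unitDisc)
    (v : ℂ) : HasFDerivAt (fun y => fderiv ℝ f y v) ((fderiv ℝ (fderiv ℝ f) z).flip v) z := by
  have h1 : ContDiffAt ℝ 2 f z := hf.contDiffAt (isOpen_unitDisc.mem_nhds hz)
  have h2 : ContDiffAt ℝ 1 (fderiv ℝ f) z := h1.fderiv_right (by norm_num)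
  have h3 := (h2.differentiableAt one_ne_zero).hasFDerivAt
  refine (h3.clm_apply (hasFDerivAt_const v z)).congr_fderiv ?_
  ext u
  simp

/-- Both Christoffel symbols are complex bilinear, so the `(1,0)` part of the second-order equation
closes up: every term carries the factor `∂f`. -/
theorem hasFDerivAt_dz (hf : ContDiffOn ℝ 2 f unitDisc) (haff : DiscAffine f) {z : ℂ}
    (hz : z ∈ unitDisc) :
    HasFDerivAt (dz f) (dz f z • (((2 / (1 - ‖z‖ ^ 2) : ℝ) : ℂ) * conj z) •
      ContinuousLinearMap.id ℝ ℂ - (dz f z * (((2 / (1 - ‖f z‖ ^ 2) : ℝ) : ℂ) * conj (f z))) •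
        fderiv ℝ f z) z := by
  have h := ((hasFDerivAt_fderiv_apply hf hz 1).sub
    ((hasFDerivAt_fderiv_apply hf hz I).const_mul I)).mul_const (2⁻¹ : ℂ)
  refine (h.congr_of_eventuallyEq (.of_forall fun y => ?_)).congr_fderiv ?_
  · simp [dz, div_eq_mul_inv]
  · ext u
    simp only [smul_apply, sub_apply,
      ContinuousLinearMap.flip_apply, smul_eq_mul, ContinuousLinearMap.id_apply, haff z hz u]
    rw [fderiv_eq_dz_add_dzbar f z u, fderiv_eq_dz_add_dzbar f z (_ * _),
      fderiv_eq_dz_add_dzbar f z (_ * _), fderiv_eq_dz_add_dzbar f z 1,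
      fderiv_eq_dz_add_dzbar f z I]
    simp only [map_mul, conj_ofReal, conj_conj, conj_I, map_one]
    ring_nf
    simp only [I_sq]
    ring

theorem hasFDerivAt_dzbar (hf : ContDiffOn ℝ 2 f unitDisc) (haff : DiscAffine f) {z : ℂ}
    (hz : z ∈ unitDisc) :
    HasFDerivAt (dzbar f) (dzbar f z • (((2 / (1 - ‖z‖ ^ 2) : ℝ) : ℂ) * z) •
      (conjCLE : ℂ →L[ℝ] ℂ) - (dzbar f z * (((2 / (1 - ‖f z‖ ^ 2) : ℝ) : ℂ) * conj (f z))) •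
        fderiv ℝ f z) z := by
  have h := ((hasFDerivAt_fderiv_apply hf hz 1).add
    ((hasFDerivAt_fderiv_apply hf hz I).const_mul I)).mul_const (2⁻¹ : ℂ)
  refine (h.congr_of_eventuallyEq (.of_forall fun y => ?_)).congr_fderiv ?_
  · simp [dzbar, div_eq_mul_inv]
  · ext u
    simp only [smul_apply, sub_apply,
      add_apply, ContinuousLinearEquiv.coe_coe, conjCLE_apply,
      ContinuousLinearMap.flip_apply, smul_eq_mul, haff z hz u]
    rw [fderiv_eq_dz_add_dzbar f z u, fderiv_eq_dz_add_dzbar f z (_ * _),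
      fderiv_eq_dz_add_dzbar f z (_ * _), fderiv_eq_dz_add_dzbar f z 1,
      fderiv_eq_dz_add_dzbar f z I]
    simp only [map_mul, conj_ofReal, conj_conj, conj_I, map_one]
    ring_nf
    simp only [I_sq]
    ring

theorem hasFDerivAt_conj {X : ℂ → ℂ} {X' : ℂ →L[ℝ] ℂ} {z : ℂ} (h : HasFDerivAt X X' z) :
    HasFDerivAt (fun y => conj (X y)) ((conjCLE : ℂ →L[ℝ] ℂ).comp X') z :=
  (conjCLE : ℂ →L[ℝ] ℂ).hasFDerivAt.comp z h

theorem hasFDerivAt_one_sub_sq_norm {X : ℂ → ℂ} {X' : ℂ →L[ℝ] ℂ} {z : ℂ}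
    (h : HasFDerivAt X X' z) :
    HasFDerivAt (fun y => ((1 - ‖X y‖ ^ 2 : ℝ) : ℂ))
      (-(conj (X z) • X' + X z • (conjCLE : ℂ →L[ℝ] ℂ).comp X')) z := by
  refine (((hasFDerivAt_conj h).mul h).const_sub 1 |>.congr_of_eventuallyEq
    (.of_forall fun y => ?_)).congr_fderiv rfl
  simp [Complex.conj_mul']

theorem hasFDerivAt_inv_sq {X : ℂ → ℂ} {X' : ℂ →L[ℝ] ℂ} {z : ℂ} (h : HasFDerivAt X X' z)
    (h0 : X z ≠ 0) :
    HasFDerivAt (fun y => (X y ^ 2)⁻¹) ((-2 * (X z ^ 3)⁻¹) • X') z := by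
  have h1 : HasDerivAt (fun w : ℂ => (w ^ 2)⁻¹) (-2 * (X z ^ 3)⁻¹) (X z) := by
    refine ((hasDerivAt_pow 2 (X z)).inv (pow_ne_zero 2 h0)).congr_deriv ?_
    field_simp
    norm_num
    ring
  refine ((h1.hasFDerivAt.restrictScalars ℝ).comp z h).congr_fderiv ?_
  ext u
  simp [mul_comm]

theorem one_sub_sq_norm_ofReal_ne_zero {z : ℂ} (hz : z ∈ unitDisc) :
    ((1 - ‖z‖ ^ 2 : ℝ) : ℂ) ≠ 0 := ofReal_ne_zero.2 (one_sub_sq_norm_pos hz).ne'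

/-- The Hopf differential of a totally geodesic map is parallel. -/
theorem hasFDerivAt_hopf (hf : ContDiffOn ℝ 2 f unitDisc) (hmaps : MapsTo f unitDisc unitDisc)
    (haff : DiscAffine f) {z : ℂ} (hz : z ∈ unitDisc) :
    HasFDerivAt (fun y => dz f y * conj (dzbar f y) * (((1 - ‖f y‖ ^ 2 : ℝ) : ℂ) ^ 2)⁻¹)
      ((dz f z * conj (dzbar f z) * (((1 - ‖f z‖ ^ 2 : ℝ) : ℂ) ^ 2)⁻¹ *
        (2 * ((2 / (1 - ‖z‖ ^ 2) : ℝ) : ℂ) * conj z)) • ContinuousLinearMap.id ℝ ℂ) z := by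
  have hfz : HasFDerivAt f (fderiv ℝ f z) z :=
    ((hf.contDiffAt (isOpen_unitDisc.mem_nhds hz)).differentiableAt two_ne_zero).hasFDerivAt
  have h0 := one_sub_sq_norm_ofReal_ne_zero (hmaps hz)
  refine (((hasFDerivAt_dz hf haff hz).mul (hasFDerivAt_conj (hasFDerivAt_dzbar hf haff hz))).mul
    (hasFDerivAt_inv_sq (hasFDerivAt_one_sub_sq_norm hfz) h0)).congr_fderiv ?_
  ext u
  simp only [smul_apply, sub_apply,
    add_apply, ContinuousLinearEquiv.coe_coe, conjCLE_apply,
    ContinuousLinearMap.comp_apply, neg_apply, Pi.mul_apply,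
    smul_eq_mul, ContinuousLinearMap.id_apply, map_sub, map_mul, conj_ofReal, conj_conj]
  simp only [ofReal_div, ofReal_ofNat]
  -- The terms in `Df` cancel against the derivative of the weight `n⁻²`, for any nonzero `n`.
  generalize ((1 - ‖f z‖ ^ 2 : ℝ) : ℂ) = n at h0 ⊢
  field_simp
  ring

/-- The energy density of the holomorphic part of a totally geodesic map is constant. -/
theorem hasFDerivAt_energy_dz (hf : ContDiffOn ℝ 2 f unitDisc)
    (hmaps : MapsTo f unitDisc unitDisc) (haff : DiscAffine f) {z : ℂ} (hz : z ∈ unitDisc) :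
    HasFDerivAt (fun y => dz f y * conj (dz f y) * (((1 - ‖f y‖ ^ 2 : ℝ) : ℂ) ^ 2)⁻¹ *
      (((1 - ‖y‖ ^ 2 : ℝ) : ℂ) * ((1 - ‖y‖ ^ 2 : ℝ) : ℂ))) (0 : ℂ →L[ℝ] ℂ) z := by
  have hfz : HasFDerivAt f (fderiv ℝ f z) z :=
    ((hf.contDiffAt (isOpen_unitDisc.mem_nhds hz)).differentiableAt two_ne_zero).hasFDerivAt
  have h0 := one_sub_sq_norm_ofReal_ne_zero (hmaps hz)
  have h1 := one_sub_sq_norm_ofReal_ne_zero hz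
  have hE := hasFDerivAt_one_sub_sq_norm (hasFDerivAt_id (𝕜 := ℝ) z)
  refine ((((hasFDerivAt_dz hf haff hz).mul (hasFDerivAt_conj (hasFDerivAt_dz hf haff hz))).mul
    (hasFDerivAt_inv_sq (hasFDerivAt_one_sub_sq_norm hfz) h0)).mul
      (hE.mul hE)).congr_fderiv ?_
  ext u
  simp only [smul_apply, sub_apply,
    add_apply, ContinuousLinearEquiv.coe_coe, conjCLE_apply,
    ContinuousLinearMap.comp_apply, neg_apply, Pi.mul_apply, id_eq,
    smul_eq_mul, ContinuousLinearMap.id_apply, map_sub, map_mul, conj_ofReal, conj_conj,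
    zero_apply]
  simp only [ofReal_div, ofReal_ofNat]
  generalize ((1 - ‖f z‖ ^ 2 : ℝ) : ℂ) = n at h0 ⊢
  generalize ((1 - ‖z‖ ^ 2 : ℝ) : ℂ) = m at h1 ⊢
  field_simp
  ring

/-- The energy density of the antiholomorphic part of a totally geodesic map is constant. -/
theorem hasFDerivAt_energy_dzbar (hf : ContDiffOn ℝ 2 f unitDisc)
    (hmaps : MapsTo f unitDisc unitDisc) (haff : DiscAffine f) {z : ℂ} (hz : z ∈ unitDisc) :
    HasFDerivAt (fun y => dzbar f y * conj (dzbar f y) * (((1 - ‖f y‖ ^ 2 : ℝ) : ℂ) ^ 2)⁻¹ *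
      (((1 - ‖y‖ ^ 2 : ℝ) : ℂ) * ((1 - ‖y‖ ^ 2 : ℝ) : ℂ))) (0 : ℂ →L[ℝ] ℂ) z := by
  have hfz : HasFDerivAt f (fderiv ℝ f z) z :=
    ((hf.contDiffAt (isOpen_unitDisc.mem_nhds hz)).differentiableAt two_ne_zero).hasFDerivAt
  have h0 := one_sub_sq_norm_ofReal_ne_zero (hmaps hz)
  have h1 := one_sub_sq_norm_ofReal_ne_zero hz
  have hE := hasFDerivAt_one_sub_sq_norm (hasFDerivAt_id (𝕜 := ℝ) z)
  refine ((((hasFDerivAt_dzbar hf haff hz).mul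
    (hasFDerivAt_conj (hasFDerivAt_dzbar hf haff hz))).mul
    (hasFDerivAt_inv_sq (hasFDerivAt_one_sub_sq_norm hfz) h0)).mul
      (hE.mul hE)).congr_fderiv ?_
  ext u
  simp only [smul_apply, sub_apply,
    add_apply, ContinuousLinearEquiv.coe_coe, conjCLE_apply,
    ContinuousLinearMap.comp_apply, neg_apply, Pi.mul_apply, id_eq,
    smul_eq_mul, ContinuousLinearMap.id_apply, map_sub, map_mul, conj_ofReal, conj_conj,
    zero_apply]
  simp only [ofReal_div, ofReal_ofNat]
  generalize ((1 - ‖f z‖ ^ 2 : ℝ) : ℂ) = n at h0 ⊢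
  generalize ((1 - ‖z‖ ^ 2 : ℝ) : ℂ) = m at h1 ⊢
  field_simp
  ring

/-- Square root of a locally constant density on the connected disc. `D` is arbitrary so as to serve
both `∂f` and `∂̄f`. -/
theorem exists_const_of_hasFDerivAt_zero {D : ℂ → ℂ}
    (h : ∀ z ∈ unitDisc, HasFDerivAt (fun y => D y * conj (D y) *
      (((1 - ‖f y‖ ^ 2 : ℝ) : ℂ) ^ 2)⁻¹ *
      (((1 - ‖y‖ ^ 2 : ℝ) : ℂ) * ((1 - ‖y‖ ^ 2 : ℝ) : ℂ))) (0 : ℂ →L[ℝ] ℂ) z)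
    (hmaps : MapsTo f unitDisc unitDisc) :
    ∃ c : ℝ, ∀ z ∈ unitDisc, ‖D z‖ * (1 - ‖z‖ ^ 2) = c * (1 - ‖f z‖ ^ 2) := by
  have hc : ∀ z ∈ unitDisc, _ = _ := fun z hz => isOpen_unitDisc.is_const_of_fderiv_eq_zero
    isPreconnected_unitDisc (fun z hz => (h z hz).differentiableAt.differentiableWithinAt)
    (fun z hz => (h z hz).fderiv) hz zero_mem_unitDisc
  refine ⟨‖D 0‖ / (1 - ‖f 0‖ ^ 2), fun z hz => ?_⟩
  have h1 := one_sub_sq_norm_pos hz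
  have h2 := one_sub_sq_norm_pos (hmaps hz)
  have h3 := one_sub_sq_norm_pos (hmaps zero_mem_unitDisc)
  have h4 := congrArg norm (hc z hz)
  simp only [norm_mul, norm_inv, norm_pow, RCLike.norm_conj, Complex.norm_real,
    Real.norm_of_nonneg h1.le, Real.norm_of_nonneg h2.le, Real.norm_of_nonneg h3.le] at h4
  rw [← div_eq_iff h2.ne']
  refine (pow_left_inj₀ (by positivity) (by positivity) two_ne_zero).1 ?_
  simp at h4
  rw [div_pow, mul_pow, div_pow]
  field_simp at h4 ⊢
  linarith

/-- A totally geodesic self-map of the disc is holomorphic or antiholomorphic. -/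
theorem dz_eq_zero_or_dzbar_eq_zero (hf : ContDiffOn ℝ 2 f unitDisc)
    (hmaps : MapsTo f unitDisc unitDisc) (haff : DiscAffine f) :
    (∀ z ∈ unitDisc, dz f z = 0) ∨ ∀ z ∈ unitDisc, dzbar f z = 0 := by
  obtain ⟨a, ha⟩ := exists_const_of_hasFDerivAt_zero
    (fun z hz => hasFDerivAt_energy_dz hf hmaps haff hz) hmaps
  obtain ⟨b, hb⟩ := exists_const_of_hasFDerivAt_zero
    (fun z hz => hasFDerivAt_energy_dzbar hf hmaps haff hz) hmaps
  have key : ∀ {c : ℝ} {D : ℂ → ℂ},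
      (∀ z ∈ unitDisc, ‖D z‖ * (1 - ‖z‖ ^ 2) = c * (1 - ‖f z‖ ^ 2)) → c = 0 →
      ∀ z ∈ unitDisc, D z = 0 := fun h hc z hz => by
    have h1 := h z hz
    rw [hc, zero_mul, mul_eq_zero, norm_eq_zero] at h1
    exact h1.resolve_right (one_sub_sq_norm_pos hz).ne'
  by_cases ha0 : a = 0
  · exact Or.inl (key ha ha0)
  by_cases hb0 : b = 0
  · exact Or.inr (key hb hb0)
  exfalso
  set H : ℂ → ℂ := fun y => dz f y * conj (dzbar f y) * (((1 - ‖f y‖ ^ 2 : ℝ) : ℂ) ^ 2)⁻¹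
    with hH
  have hnorm : ∀ z ∈ unitDisc, ‖H z‖ * (1 - ‖z‖ ^ 2) ^ 2 = a * b := fun z hz => by
    have h1 := (one_sub_sq_norm_pos (hmaps hz))
    rw [hH]
    simp only [norm_mul, norm_inv, norm_pow, RCLike.norm_conj, Complex.norm_real,
      Real.norm_of_nonneg h1.le]
    have h2 := congrArg₂ (· * ·) (ha z hz) (hb z hz)
    field_simp
    linarith
  have hab : a * b ≠ 0 := mul_ne_zero ha0 hb0
  have hHne : ∀ z ∈ unitDisc, H z ≠ 0 := fun z hz h => hab <| by
    rw [← hnorm z hz, h, norm_zero, zero_mul]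
  have hHd : DifferentiableOn ℂ H unitDisc := fun z hz => by
    have h1 := hasFDerivAt_hopf hf hmaps haff hz
    refine (differentiableAt_complex_iff_differentiableAt_real.2
      ⟨h1.differentiableAt, ?_⟩).differentiableWithinAt
    -- The real derivative is a complex multiple of the identity, which is the Cauchy–Riemann
    -- condition.
    rw [h1.fderiv]
    simp [mul_comm]
  have hmax : IsMaxOn (norm ∘ fun z => (H z)⁻¹) unitDisc 0 := fun z hz => by
    simp only [mem_ofPred_eq, Function.comp_apply, norm_inv]
    refine inv_anti₀ (norm_pos_iff.2 (hHne 0 zero_mem_unitDisc)) ?_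
    have h0 := hnorm 0 zero_mem_unitDisc
    have h1 := one_sub_sq_norm_pos hz
    have h2 : (1 - ‖z‖ ^ 2) ^ 2 ≤ 1 := pow_le_one₀ h1.le (by linarith [sq_nonneg ‖z‖])
    rw [norm_zero] at h0
    have h3 := hnorm z hz
    nlinarith [norm_nonneg (H z)]
  -- Constancy of `H` contradicts `|H|(1-|z|²)² = ab`, as the weight is `1` at `0` and `9/16` here.
  have hhalf : (1 / 2 : ℂ) ∈ unitDisc := by rw [mem_unitDisc]; norm_num
  have hconst := Complex.eqOn_of_isPreconnected_of_isMaxOn_norm isPreconnected_unitDisc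
    isOpen_unitDisc (hHd.inv hHne) zero_mem_unitDisc hmax hhalf
  have h1 : H (1 / 2) = H 0 := inv_injective hconst
  have h2 := hnorm _ hhalf
  have h3 := hnorm 0 zero_mem_unitDisc
  rw [h1] at h2
  norm_num at h2 h3
  rw [← h3] at h2
  have h4 := norm_pos_iff.2 (hHne 0 zero_mem_unitDisc)
  linarith

/-- A totally geodesic self-map `f` of the disc is either constant, or an isometry; in the second
case `f` is an automorphism or the conjugate of one. -/
theorem DiscAffine.classification (hf : ContDiffOn ℝ 2 f unitDisc)
    (hmaps : MapsTo f unitDisc unitDisc) (haff : DiscAffine f) :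
    (∀ z ∈ unitDisc, f z = f 0) ∨
      (‖fderiv ℝ f 0 1‖ = 1 - ‖f 0‖ ^ 2 ∧ ∃ u : ℂ, ‖u‖ = 1 ∧
        ((∀ z ∈ unitDisc, discMoebius u (f 0) (f z) = z) ∨
          ∀ z ∈ unitDisc, discMoebius u (f 0) (f z) = conj z)) := by
  have hfz : ∀ z ∈ unitDisc, HasFDerivAt f (fderiv ℝ f z) z := fun z hz =>
    ((hf.contDiffAt (isOpen_unitDisc.mem_nhds hz)).differentiableAt two_ne_zero).hasFDerivAt
  rcases dz_eq_zero_or_dzbar_eq_zero hf hmaps haff with h0 | h0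
  · obtain ⟨c, hc⟩ := exists_const_of_hasFDerivAt_zero
      (fun z hz => hasFDerivAt_energy_dzbar hf hmaps haff hz) hmaps
    -- Antiholomorphic case: the homothety lemma is applied to `conj f` and its conclusion
    -- conjugated back.
    have hd : ∀ z ∈ unitDisc, HasDerivAt (fun y => conj (f y)) (conj (dzbar f z)) z := by
      intro z hz
      rw [hasDerivAt_iff_hasFDerivAt]
      refine hasFDerivAt_of_restrictScalars ℝ (hasFDerivAt_conj (hfz z hz)) ?_
      ext u
      simp [fderiv_eq_dz_add_dzbar, h0 z hz, mul_comm]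
    rcases const_or_aut_of_homothety (c := c)
      (fun z hz => (hd z hz).differentiableAt.differentiableWithinAt)
      (fun z hz => conj_mem_unitDisc.2 (hmaps hz))
      (fun z hz => by rw [(hd z hz).deriv, RCLike.norm_conj, RCLike.norm_conj, hc z hz])
      with ⟨-, h⟩ | ⟨h1, u, hu, h⟩
    · exact Or.inl fun z hz => (starRingEnd ℂ).injective (h z hz)
    · refine Or.inr ⟨?_, conj u, by rw [RCLike.norm_conj, hu], Or.inr fun z hz => ?_⟩
      · have := hc 0 zero_mem_unitDisc
        simpa [fderiv_eq_dz_add_dzbar, h0 0 zero_mem_unitDisc, h1] using this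
      · have := congrArg conj (h z hz)
        rwa [conj_discMoebius, conj_conj, conj_conj] at this
  · obtain ⟨c, hc⟩ := exists_const_of_hasFDerivAt_zero
      (fun z hz => hasFDerivAt_energy_dz hf hmaps haff hz) hmaps
    have hd : ∀ z ∈ unitDisc, HasDerivAt f (dz f z) z := by
      intro z hz
      rw [hasDerivAt_iff_hasFDerivAt]
      refine hasFDerivAt_of_restrictScalars ℝ (hfz z hz) ?_
      ext u
      simp [fderiv_eq_dz_add_dzbar, h0 z hz, mul_comm]
    rcases const_or_aut_of_homothety (c := c)
      (fun z hz => (hd z hz).differentiableAt.differentiableWithinAt) hmaps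
      (fun z hz => by rw [(hd z hz).deriv, hc z hz])
      with ⟨-, h⟩ | ⟨h1, u, hu, h⟩
    · exact Or.inl h
    · refine Or.inr ⟨?_, u, hu, Or.inl h⟩
      have := hc 0 zero_mem_unitDisc
      simpa [fderiv_eq_dz_add_dzbar, h0 0 zero_mem_unitDisc, h1] using this

end Wirtinger

/-! ### Totally geodesic maps into the polydisc -/

theorem isHolomorphicAut_polydisc {p : ℕ} (σ : Equiv.Perm (Fin p)) {u a : Fin p → ℂ}
    (hu : ∀ j, ‖u j‖ = 1) (ha : ∀ j, a j ∈ unitDisc) :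
    IsHolomorphicAut (polydisc p) (fun w j => discMoebius (u (σ j)) (a (σ j)) (w (σ j))) := by
  have hu' : ∀ j, ‖conj (u j)‖ = 1 := fun j => by rw [RCLike.norm_conj, hu]
  have ha' : ∀ j, -(u j * a j) ∈ unitDisc := fun j => by
    rw [mem_unitDisc, norm_neg, norm_mul, hu, one_mul]; exact mem_unitDisc.1 (ha j)
  refine ⟨fun w j => discMoebius (conj (u j)) (-(u j * a j)) (w (σ.symm j)),
    fun w hw j => discMoebius_mem_unitDisc (hu _) (ha _) (hw _),
    fun w hw j => discMoebius_mem_unitDisc (hu' _) (ha' _) (hw _), ⟨?_, ?_⟩, ?_, ?_⟩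
  · intro w hw
    funext j
    simp only [Equiv.apply_symm_apply]
    exact discMoebius_inverse (hu j) (ha j) (hw j)
  · intro w hw
    funext j
    simp only [Equiv.symm_apply_apply]
    exact discMoebius_inverse_right (hu _) (ha _) (hw j)
  · exact differentiableOn_pi.2 fun j => (differentiableOn_discMoebius _ (ha _)).comp
      (differentiable_apply (σ j)).differentiableOn fun w hw => hw (σ j)
  · exact differentiableOn_pi.2 fun j => (differentiableOn_discMoebius _ (ha' _)).comp
      (differentiable_apply (σ.symm j)).differentiableOn fun w hw => hw (σ.symm j)

/-- Some permutation of `Fin p` moves the first `#S` elements onto `S`. -/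
theorem exists_perm_lt_card_iff {p : ℕ} (S : Finset (Fin p)) :
    ∃ σ : Equiv.Perm (Fin p), ∀ j, σ j ∈ S ↔ (j : ℕ) < S.card := by
  have hle : S.card ≤ p := by simpa using S.card_le_univ
  have e : {j : Fin p // (j : ℕ) < S.card} ≃ {j // j ∈ S} :=
    Fintype.equivOfCardEq (by
      rw [Fintype.card_coe, Fintype.card_subtype]
      simpa [hle] using Fin.card_filter_val_lt (n := p) (m := S.card))
  refine ⟨e.extendSubtype, fun j => ⟨fun h => ?_, fun h => e.extendSubtype_mem j h⟩⟩
  by_contra hj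
  exact e.extendSubtype_not_mem j hj h

section Components

variable {p : ℕ} {f : ℂ → Fin p → ℂ}

theorem fderiv_component (hf : ContDiffOn ℝ 2 f unitDisc) (j : Fin p) {z : ℂ}
    (hz : z ∈ unitDisc) (u : ℂ) : fderiv ℝ (fun y => f y j) z u = fderiv ℝ f z u j := by
  have h := ((hf.contDiffAt (isOpen_unitDisc.mem_nhds hz)).differentiableAt
    two_ne_zero).hasFDerivAt
  rw [(hasFDerivAt_pi'.1 h j).fderiv]
  rfl

theorem fderiv_fderiv_component (hf : ContDiffOn ℝ 2 f unitDisc) (j : Fin p) {z : ℂ}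
    (hz : z ∈ unitDisc) (u v : ℂ) :
    fderiv ℝ (fderiv ℝ fun y => f y j) z u v = fderiv ℝ (fderiv ℝ f) z u v j := by
  have h1 : ContDiffAt ℝ 2 f z := hf.contDiffAt (isOpen_unitDisc.mem_nhds hz)
  have h2 : ContDiffAt ℝ 1 (fderiv ℝ f) z := h1.fderiv_right (by norm_num)
  have h3 := (h2.differentiableAt one_ne_zero).hasFDerivAt
  have heq : (fderiv ℝ fun y => f y j) =ᶠ[nhds z] fun y =>
      (ContinuousLinearMap.compL ℝ ℂ (Fin p → ℂ) ℂ
        (ContinuousLinearMap.proj j)) (fderiv ℝ f y) := by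
    filter_upwards [isOpen_unitDisc.mem_nhds hz] with y hy
    ext w
    exact fderiv_component hf j hy w
  have h4 := ((ContinuousLinearMap.compL ℝ ℂ (Fin p → ℂ) ℂ
    (ContinuousLinearMap.proj j)).hasFDerivAt.comp z h3).congr_of_eventuallyEq heq
  rw [h4.fderiv]
  rfl

/-- The components of a totally geodesic map into the polydisc are totally geodesic. -/
theorem IsTotallyGeodesic.discAffine_component {c : ℝ} (hc : c ≠ 0)
    (hf : ContDiffOn ℝ 2 f unitDisc) (hmaps : MapsTo f unitDisc (polydisc p))
    (h : IsTotallyGeodesic unitDisc (fun z => c • discMetric z)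
      (polydisc p) (polydiscMetric p) f) (j : Fin p) : DiscAffine fun z => f z j := by
  obtain ⟨Γ, Γ', hΓ, hΓ', hgeod⟩ := h
  intro z hz u v
  have h1 := congrFun (hgeod z hz u v) j
  rw [hΓ.eq_of_disc hc hz] at h1
  simp only [Pi.sub_apply, Pi.add_apply, Pi.zero_apply, hΓ'.eq_of_polydisc (hmaps hz)] at h1
  rw [fderiv_fderiv_component hf j hz, fderiv_component hf j hz, fderiv_component hf j hz,
    fderiv_component hf j hz]
  linear_combination h1

end Components

theorem proposition3p2 (p : ℕ) (lam : ℝ) (hlam : 0 < lam) (f : ℂ → Fin p → ℂ)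
    (hiso : IsIsometricEmbedding unitDisc (fun z => lam • discMetric z)
      (polydisc p) (polydiscMetric p) f)
    (hgeod : IsTotallyGeodesic unitDisc (fun z => lam • discMetric z)
      (polydisc p) (polydiscMetric p) f)
    (hext : ∃ F : ℂ → Fin p → ℂ,
      ContDiffOn ℝ 1 F (closure unitDisc) ∧ EqOn F f unitDisc) :
    ∃ n : ℕ, 0 < n ∧ n ≤ p ∧ lam = n ∧
      ∃ Φ : (Fin p → ℂ) → (Fin p → ℂ), IsHolomorphicAut (polydisc p) Φ ∧
        ∀ j : Fin p,
          ((j : ℕ) < n →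
            (∀ ζ ∈ unitDisc, Φ (f ζ) j = ζ) ∨ (∀ ζ ∈ unitDisc, Φ (f ζ) j = conj ζ)) ∧
          (n ≤ (j : ℕ) → ∀ ζ ∈ unitDisc, Φ (f ζ) j = 0) := by
  classical
  have hf := hiso.contDiffOn
  have hmaps : ∀ j, MapsTo (fun z => f z j) unitDisc unitDisc := fun j z hz => hiso.mapsTo hz j
  have hclass := fun j => DiscAffine.classification (contDiffOn_pi.1 hf j) (hmaps j)
    (hgeod.discAffine_component hlam.ne' hf hiso.mapsTo j)
  set S : Finset (Fin p) := {j | ¬ ∀ z ∈ unitDisc, f z j = f 0 j} with hS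
  have hmem : ∀ j, j ∈ S ↔ ¬ ∀ z ∈ unitDisc, f z j = f 0 j := fun j => by simp [hS]
  have hu : ∀ j, ∃ u : ℂ, ‖u‖ = 1 ∧ (j ∈ S →
      (∀ z ∈ unitDisc, discMoebius u (f 0 j) (f z j) = z) ∨
        ∀ z ∈ unitDisc, discMoebius u (f 0 j) (f z j) = conj z) := by
    intro j
    by_cases hj : j ∈ S
    · obtain ⟨-, u, hu, h⟩ := (hclass j).resolve_left ((hmem j).1 hj)
      exact ⟨u, hu, fun _ => h⟩
    -- For a constant component any rotation will do: the Möbius map already sends its value to `0`.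
    · exact ⟨1, norm_one, fun h => absurd h hj⟩
  choose u hu1 hu2 using hu
  have hlamS : lam = S.card := by
    have hterm : ∀ j, discMetric (f 0 j) (fderiv ℝ f 0 1 j) (fderiv ℝ f 0 1 j) =
        if j ∈ S then 2 else 0 := by
      intro j
      have hpos := one_sub_sq_norm_pos (hmaps j zero_mem_unitDisc)
      rw [discMetric_apply, real_inner_self_eq_norm_sq, ← fderiv_component hf j zero_mem_unitDisc]
      split_ifs with hj
      · rw [((hclass j).resolve_left ((hmem j).1 hj)).1]
        field_simp
      · have hconst : (fun z => f z j) =ᶠ[nhds 0] fun _ => f 0 j := by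
          filter_upwards [isOpen_unitDisc.mem_nhds zero_mem_unitDisc] with z hz
          exact not_not.1 ((hmem j).not.1 hj) z hz
        rw [hconst.fderiv_eq]
        simp
    -- At the origin on the vector `1` this reads `2 · #S = 2λ`.
    have hpull := hiso.pullback 0 zero_mem_unitDisc 1 1
    rw [polydiscMetric_apply, Finset.sum_congr rfl fun j _ => hterm j] at hpull
    simp [discMetric_apply] at hpull
    linarith
  obtain ⟨σ, hσ⟩ := exists_perm_lt_card_iff S
  refine ⟨S.card, by exact_mod_cast hlamS ▸ hlam, by simpa using S.card_le_univ, hlamS, _,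
    isHolomorphicAut_polydisc σ hu1 (fun j => hmaps j zero_mem_unitDisc), fun j => ⟨fun hj => ?_,
      fun hj z hz => ?_⟩⟩
  · exact hu2 (σ j) ((hσ j).2 hj)
  · have h1 : σ j ∉ S := (hσ j).not.2 (not_lt.2 hj)
    have h2 := not_not.1 ((hmem (σ j)).not.1 h1) z hz
    simp [discMoebius, h2]
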